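/- Let $R$ be a non-trivial associative ring with identity; "$R$-module" means left $R$-module. For an integer $m\ge 0$, an $R$-module $N$ is called $m$-presented if there is an exact sequence of $R$-modules $F_m\to F_{m-1}\to\cdots\to F_0\to N\to 0$ in which each $F_i$ is finitely generated and free. Let $n\ge 1$ be an integer, let $\mathscr{X}$ be a class of $R$-modules, and let $\mathscr{X}_n$ be the subclass of the $n$-presented modules in $\mathscr{X}$. Say that $R$ is left $n$-$\mathscr{X}$-coherent if $\mathscr{X}_n$ is non-empty and every module in $\mathscr{X}_n$ is $(n+1)$-presented; that a right $R$-module $M$ is $n$-$\mathscr{X}$-flat if $\mathrm{Tor}^R_n(M,N)=0$ for every $N\in\mathscr{X}_n$; and that an $R$-module $M$ is $n$-$\mathscr{X}$-injective if $\mathrm{Ext}_R^n(N,M)=0$ for every $N\in\mathscr{X}_n$. For a left (resp. right) $R$-module $M$, let $M^*=\mathrm{Hom}_{\mathbb{Z}}(M,\mathbb{Q}/\mathbb{Z})$ be its character module, which is a right (resp. left) $R$-module. **Theorem.** Suppose that $\mathscr{X}_n$ is not empty. Then the following assertions are equivalent: 1. $R$ is left $n$-$\mathscr{X}$-coherent;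 2. for every $R$-module $M$: $M$ is $n$-$\mathscr{X}$-injective if and only if $M^*$ is $n$-$\mathscr{X}$-flat; 3. for every $R$-module $M$: $M$ is $n$-$\mathscr{X}$-injective if and only if $M^{**}$ is $n$-$\mathscr{X}$-injective; 4. for every right $R$-module $M$: $M$ is $n$-$\mathscr{X}$-flat if and only if $M^{**}$ is $n$-$\mathscr{X}$-flat. -/

import Mathlib

open CategoryTheory TensorProduct

universe u

namespace RelCoherent

/-! Conventions: `R` is an associative ring with identity, left `R`-modules are objects of
`ModuleCat R`, and right `R`-modules are objects of `ModuleCat Rᵐᵒᵖ` (so that `m · r` is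
`MulOpposite.op r • m`). -/

section Presented

/-- `M` is `n`-presented: there is an exact sequence `F_n → ⋯ → F_1 → F_0 → M → 0`
with each `F_i = R ^ (k i)` finitely generated and free.
The data `k i`, `d i` that lie beyond `F_n` are not constrained. -/
def IsNPresented {R : Type u} [Ring R] (n : ℕ) (M : ModuleCat.{u} R) : Prop :=
  ∃ (k : ℕ → ℕ) (ε : (Fin (k 0) → R) →ₗ[R] M)
    (d : ∀ i : ℕ, (Fin (k (i + 1)) → R) →ₗ[R] (Fin (k i) → R)),
    Function.Surjective ε ∧
    (0 < n → Function.Exact (d 0) ε) ∧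
    (∀ i : ℕ, i + 1 < n → Function.Exact (d (i + 1)) (d i))

/-- The subclass `X_n` of the `n`-presented modules of a class `X` of left `R`-modules. -/
def nPresentedPart {R : Type u} [Ring R] (n : ℕ) (X : Set (ModuleCat.{u} R)) :
    Set (ModuleCat.{u} R) :=
  {N | N ∈ X ∧ IsNPresented n N}

/-- `R` is left `n`-`X`-coherent: `X_n` is not empty and each of its members is
`(n+1)`-presented. -/
def IsLeftCoherent {R : Type u} [Ring R] (n : ℕ) (X : Set (ModuleCat.{u} R)) : Prop :=
  (nPresentedPart n X).Nonempty ∧ ∀ N ∈ nPresentedPart n X, IsNPresented (n + 1) N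

end Presented

section Tensor

/-- The subgroup of `M ⊗_ℤ N` generated by the elements `(m · r) ⊗ n - m ⊗ (r · n)`. -/
def balancingSubgroup (R : Type u) [Ring R] (M N : Type u) [AddCommGroup M] [Module Rᵐᵒᵖ M]
    [AddCommGroup N] [Module R N] : AddSubgroup (M ⊗[ℤ] N) :=
  AddSubgroup.closure
    {z | ∃ (m : M) (r : R) (n : N), z = (MulOpposite.op r • m) ⊗ₜ[ℤ] n - m ⊗ₜ[ℤ] (r • n)}

/-- The tensor product `M ⊗_R N` of a right and a left `R`-module, an abelian group. -/
abbrev BalancedTensor (R : Type u) [Ring R] (M N : Type u) [AddCommGroup M] [Module Rᵐᵒᵖ M]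
    [AddCommGroup N] [Module R N] : Type u :=
  (M ⊗[ℤ] N) ⧸ balancingSubgroup R M N

/-- The homomorphism `M ⊗_ℤ N → M ⊗_ℤ N'` induced by an `R`-linear map `N → N'`. -/
noncomputable def intTensorMap {R : Type u} [Ring R] (M : Type u) [AddCommGroup M]
    {N N' : Type u} [AddCommGroup N] [Module R N] [AddCommGroup N'] [Module R N']
    (f : N →ₗ[R] N') : (M ⊗[ℤ] N) →+ (M ⊗[ℤ] N') :=
  (LinearMap.lTensor M f.toAddMonoidHom.toIntLinearMap).toAddMonoidHom

theorem intTensorMap_tmul {R : Type u} [Ring R] (M : Type u) [AddCommGroup M]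
    {N N' : Type u} [AddCommGroup N] [Module R N] [AddCommGroup N'] [Module R N']
    (f : N →ₗ[R] N') (m : M) (n : N) :
    intTensorMap M f (m ⊗ₜ[ℤ] n) = m ⊗ₜ[ℤ] f n := rfl

theorem balancingSubgroup_le_comap {R : Type u} [Ring R] (M : Type u) [AddCommGroup M]
    [Module Rᵐᵒᵖ M] {N N' : Type u} [AddCommGroup N] [Module R N] [AddCommGroup N']
    [Module R N'] (f : N →ₗ[R] N') :
    balancingSubgroup R M N ≤ (balancingSubgroup R M N').comap (intTensorMap M f) := by
  refine (AddSubgroup.closure_le _).2 ?_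
  rintro _ ⟨m, r, n, rfl⟩
  refine AddSubgroup.subset_closure ⟨m, r, f n, ?_⟩
  rw [map_sub, intTensorMap_tmul, intTensorMap_tmul, map_smul]

/-- The homomorphism `M ⊗_R f : M ⊗_R N → M ⊗_R N'`, sending `m ⊗ n` to `m ⊗ f n`. -/
noncomputable def balancedTensorMap {R : Type u} [Ring R] (M : Type u) [AddCommGroup M]
    [Module Rᵐᵒᵖ M] {N N' : Type u} [AddCommGroup N] [Module R N] [AddCommGroup N']
    [Module R N'] (f : N →ₗ[R] N') : BalancedTensor R M N →+ BalancedTensor R M N' :=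
  QuotientAddGroup.map _ _ (intTensorMap M f) (balancingSubgroup_le_comap M f)

theorem balancedTensor_hom_ext {R : Type u} [Ring R] {M N : Type u} [AddCommGroup M]
    [Module Rᵐᵒᵖ M] [AddCommGroup N] [Module R N] {A : Type u} [AddCommGroup A]
    {g h : BalancedTensor R M N →+ A}
    (H : ∀ (m : M) (n : N), g (QuotientAddGroup.mk (m ⊗ₜ[ℤ] n)) =
      h (QuotientAddGroup.mk (m ⊗ₜ[ℤ] n))) : g = h := by
  ext x
  induction x using TensorProduct.induction_on with
  | zero => exact (map_zero g).trans (map_zero h).symm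
  | tmul m n => exact H m n
  | add x y hx hy =>
    simp only [AddMonoidHom.comp_apply] at hx hy ⊢
    rw [map_add, map_add, map_add, hx, hy]

/-- The functor `M ⊗_R -` from left `R`-modules to abelian groups. -/
noncomputable def tensorFunctor {R : Type u} [Ring R] (M : ModuleCat.{u} Rᵐᵒᵖ) :
    ModuleCat.{u} R ⥤ AddCommGrpCat.{u} where
  obj N := AddCommGrpCat.of (BalancedTensor R M N)
  map f := AddCommGrpCat.ofHom (balancedTensorMap M f.hom)
  map_id N := by
    ext1
    exact balancedTensor_hom_ext fun _ _ => rfl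
  map_comp f g := by
    ext1
    exact balancedTensor_hom_ext fun _ _ => rfl

instance {R : Type u} [Ring R] (M : ModuleCat.{u} Rᵐᵒᵖ) : (tensorFunctor M).Additive where
  map_add {N N' f g} := by
    ext1
    refine balancedTensor_hom_ext fun m n => ?_
    exact congrArg QuotientAddGroup.mk (TensorProduct.tmul_add m (f.hom n) (g.hom n))

/-- `Tor_n^R(M, N)`, for a right module `M` and a left module `N`: the `n`-th left derived functor
of `M ⊗_R -`, evaluated at `N`. -/
noncomputable def Tor {R : Type u} [Ring R] (n : ℕ) (M : ModuleCat.{u} Rᵐᵒᵖ)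
    (N : ModuleCat.{u} R) : AddCommGrpCat.{u} :=
  ((tensorFunctor M).leftDerived n).obj N

end Tensor

section FlatInjective

/-- The right module `M` is `n`-`X`-flat: `Tor_n^R(M, N) = 0` for every `N` in `X_n`. -/
def IsFlat {R : Type u} [Ring R] (n : ℕ) (X : Set (ModuleCat.{u} R))
    (M : ModuleCat.{u} Rᵐᵒᵖ) : Prop :=
  ∀ N ∈ nPresentedPart n X, Subsingleton (Tor n M N)

/-- The left module `M` is `n`-`X`-injective: `Ext_R^n(N, M) = 0` for every `N` in `X_n`. -/
def IsInjective {R : Type u} [Ring R] (n : ℕ) (X : Set (ModuleCat.{u} R))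
    (M : ModuleCat.{u} R) : Prop :=
  ∀ N ∈ nPresentedPart n X, Subsingleton (Abelian.Ext.{u} N M n)

end FlatInjective

section Character

/-- The right module structure on `Hom_ℤ(M, ℚ/ℤ)`, for a left module `M`:
`(f · r)(m) = f (r · m)`. -/
@[reducible] def characterRightModule (R : Type u) [Ring R] (M : Type u) [AddCommGroup M]
    [Module R M] : Module Rᵐᵒᵖ (CharacterModule M) where
  smul r f := AddMonoidHom.comp f (DistribSMul.toAddMonoidHom M r.unop)
  one_smul f := CharacterModule.ext _ fun m => congrArg f (one_smul R m)
  mul_smul r s f := CharacterModule.ext _ fun m => congrArg f (mul_smul s.unop r.unop m)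
  smul_zero _ := rfl
  smul_add _ _ _ := rfl
  add_smul r s f := CharacterModule.ext _ fun m =>
    (congrArg f (add_smul r.unop s.unop m)).trans (map_add f _ _)
  zero_smul f := CharacterModule.ext _ fun m =>
    (congrArg f (zero_smul R m)).trans (map_zero f)

/-- The left module structure on `Hom_ℤ(M, ℚ/ℤ)`, for a right module `M`:
`(r · f)(m) = f (m · r)`. -/
@[reducible] def characterLeftModule (R : Type u) [Ring R] (M : Type u) [AddCommGroup M]
    [Module Rᵐᵒᵖ M] : Module R (CharacterModule M) where
  smul r f := AddMonoidHom.comp f (DistribSMul.toAddMonoidHom M (MulOpposite.op r))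
  one_smul f := CharacterModule.ext _ fun m => congrArg f (one_smul Rᵐᵒᵖ m)
  mul_smul r s f := CharacterModule.ext _ fun m =>
    congrArg f (mul_smul (MulOpposite.op s) (MulOpposite.op r) m)
  smul_zero _ := rfl
  smul_add _ _ _ := rfl
  add_smul r s f := CharacterModule.ext _ fun m =>
    (congrArg f (add_smul (MulOpposite.op r) (MulOpposite.op s) m)).trans (map_add f _ _)
  zero_smul f := CharacterModule.ext _ fun m =>
    (congrArg f (zero_smul Rᵐᵒᵖ m)).trans (map_zero f)

/-- The character module `M^*` of a left module `M`, a right module. -/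
def charOfLeft {R : Type u} [Ring R] (M : ModuleCat.{u} R) : ModuleCat.{u} Rᵐᵒᵖ :=
  letI := characterRightModule R M
  ModuleCat.of Rᵐᵒᵖ (CharacterModule M)

/-- The character module `M^*` of a right module `M`, a left module. -/
def charOfRight {R : Type u} [Ring R] (M : ModuleCat.{u} Rᵐᵒᵖ) : ModuleCat.{u} R :=
  letI := characterLeftModule R M
  ModuleCat.of R (CharacterModule M)

end Character

end RelCoherent

/-! Write `*` for character duals. A sequence of abelian groups is exact at a term iff its dual is,
because ℚ/ℤ is an injective cogenerator. Applied to M ⊗ P for a projective resolution P of N, with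
Hom_ℤ(M ⊗ P, ℚ/ℤ) = Hom_R(P, M*), this gives Tor_n(M, N) = 0 iff Ext^n(N, M*) = 0. Hence M is flat
iff M* is injective (`isFlat_iff_isInjective`), and 2 → 3 → 4 is formal.

1 → 2: it must be seen that Ext^n(N, M) and Ext^n(N, M**) vanish together when N is (n+1)-presented.
Dimension shifting reduces this to n = 1, where vanishing is exactness of Hom(F₀, M) → Hom(F₁, M) →
Hom(F₂, M) with each F_i free of finite rank. On such F, Hom(F, M)** = Hom(F, M**), so dualizing
twice settles it (`extendsAlong_doubleDual_iff`).

4 → 1: the right module R^(I) is flat since its dual is injective, so 4 makes R^(I)*** injective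
relative to X_n. After dimension shifting, maps into R^(I)*** extend along g : R^a → R^k, and ker g
must be shown finitely generated (`fg_ker_of_extendsAlong`). Take I = ker g and E = R^(I)*. A
tautological character of E^a encodes all elements of ker g at once and is a relation over E*. The
extension property writes it with finitely many elements of ker g, and these generate. -/

namespace RelCoherent

/-! ### Exactness and characters of abelian groups. -/

section Characters

/-- The character factors through A / ker f, which embeds in B, and ℚ/ℤ is injective. -/
theorem exists_character_comp_eq {A B : Type*} [AddCommGroup A] [AddCommGroup B] (f : A →+ B)
    (χ : A →+ AddCircle (1 : ℚ)) (h : ∀ a, f a = 0 → χ a = 0) :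
    ∃ ψ : B →+ AddCircle (1 : ℚ), ∀ a, ψ (f a) = χ a := by
  have hle : f.ker ≤ χ.ker := fun a ha => h a ha
  obtain ⟨ψ, hψ⟩ := CharacterModule.dual_surjective_of_injective
    (QuotientAddGroup.kerLift f).toIntLinearMap (QuotientAddGroup.kerLift_injective f)
    (QuotientAddGroup.lift f.ker χ hle)
  exact ⟨ψ, fun a => DFunLike.congr_fun hψ (QuotientAddGroup.mk a)⟩

theorem exists_character_ne_zero_of_notMem {B : Type*} [AddCommGroup B] (S : AddSubgroup B)
    {b : B} (hb : b ∉ S) :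
    ∃ χ : B →+ AddCircle (1 : ℚ), (∀ s ∈ S, χ s = 0) ∧ χ b ≠ 0 := by
  obtain ⟨c, hc⟩ := CharacterModule.exists_character_apply_ne_zero_of_ne_zero
    (a := (QuotientAddGroup.mk b : B ⧸ S)) (by simpa [QuotientAddGroup.eq_zero_iff] using hb)
  refine ⟨AddMonoidHom.comp c (QuotientAddGroup.mk' S), fun s hs => ?_, hc⟩
  have : (QuotientAddGroup.mk s : B ⧸ S) = 0 := (QuotientAddGroup.eq_zero_iff s).2 hs
  exact (congrArg c this).trans (map_zero c)

/-- The kernel of `g` is contained in the image of `f` if and only if the same holds for the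
character duals. -/
theorem exact_iff_character_exact {A B C : Type*} [AddCommGroup A] [AddCommGroup B]
    [AddCommGroup C] (f : A →+ B) (g : B →+ C) :
    (∀ b, g b = 0 → ∃ a, f a = b) ↔
      ∀ χ : B →+ AddCircle (1 : ℚ), (∀ a, χ (f a) = 0) →
        ∃ ψ : C →+ AddCircle (1 : ℚ), ∀ b, ψ (g b) = χ b := by
  constructor
  · intro h χ hχ
    refine exists_character_comp_eq g χ fun b hb => ?_
    obtain ⟨a, rfl⟩ := h b hb
    exact hχ a
  · intro h b hb
    by_contra hn
    obtain ⟨χ, h1, h2⟩ := exists_character_ne_zero_of_notMem f.range (b := b) hn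
    obtain ⟨ψ, hψ⟩ := h χ fun a => h1 _ ⟨a, rfl⟩
    exact h2 (by rw [← hψ, hb, map_zero])

end Characters

/-! ### Elements of character modules as homomorphisms. -/

section Evaluation

variable {R : Type u} [Ring R]

/-- The underlying group of the character module of a right module. -/
def rightEval (M : ModuleCat.{u} Rᵐᵒᵖ) : charOfRight M ≃+ (M →+ AddCircle (1 : ℚ)) :=
  AddEquiv.refl (CharacterModule M)

/-- The underlying group of the character module of a left module. -/
def leftEval (M : ModuleCat.{u} R) : charOfLeft M ≃+ (M →+ AddCircle (1 : ℚ)) :=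
  AddEquiv.refl (CharacterModule M)

theorem charOfRight_ext {M : ModuleCat.{u} Rᵐᵒᵖ} {x y : charOfRight M}
    (h : ∀ m, rightEval M x m = rightEval M y m) : x = y :=
  (rightEval M).injective (AddMonoidHom.ext h)

theorem charOfLeft_ext {M : ModuleCat.{u} R} {x y : charOfLeft M}
    (h : ∀ m, leftEval M x m = leftEval M y m) : x = y :=
  (leftEval M).injective (AddMonoidHom.ext h)

@[simp]
theorem rightEval_smul (M : ModuleCat.{u} Rᵐᵒᵖ) (r : R) (x : charOfRight M) (m : M) :
    rightEval M (r • x) m = rightEval M x (MulOpposite.op r • m) := rfl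

@[simp]
theorem leftEval_smul (M : ModuleCat.{u} R) (r : Rᵐᵒᵖ) (x : charOfLeft M) (m : M) :
    leftEval M (r • x) m = leftEval M x (r.unop • m) := rfl

/-- The homomorphism to a character module that is given by a balanced pairing. -/
def toCharOfRight (M : ModuleCat.{u} Rᵐᵒᵖ) {N : Type*} [AddCommGroup N] [Module R N]
    (f : N →+ (M →+ AddCircle (1 : ℚ)))
    (hf : ∀ (r : R) (x : N) (m : M), f (r • x) m = f x (MulOpposite.op r • m)) :
    N →ₗ[R] charOfRight M where
  toFun x := (rightEval M).symm (f x)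
  map_add' x y := by rw [map_add, map_add]
  map_smul' r x := charOfRight_ext fun m => hf r x m

@[simp]
theorem rightEval_toCharOfRight (M : ModuleCat.{u} Rᵐᵒᵖ) {N : Type*} [AddCommGroup N]
    [Module R N] (f : N →+ (M →+ AddCircle (1 : ℚ)))
    (hf : ∀ (r : R) (x : N) (m : M), f (r • x) m = f x (MulOpposite.op r • m)) (x : N) :
    rightEval M (toCharOfRight M f hf x) = f x := rfl

end Evaluation

/-! ### Duality between Tor and Ext. -/

section TorExt

variable {R : Type u} [Ring R]

theorem mk_smul_tmul {M N : Type u} [AddCommGroup M] [Module Rᵐᵒᵖ M] [AddCommGroup N] [Module R N]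
    (m : M) (r : R) (n : N) :
    (QuotientAddGroup.mk ((MulOpposite.op r • m) ⊗ₜ[ℤ] n) : BalancedTensor R M N) =
      QuotientAddGroup.mk (m ⊗ₜ[ℤ] (r • n)) := by
  rw [← sub_eq_zero, ← QuotientAddGroup.mk_sub, QuotientAddGroup.eq_zero_iff]
  exact AddSubgroup.subset_closure ⟨m, r, n, rfl⟩

/-- The homomorphism `N → Hom_ℤ(M, ℚ/ℤ)` corresponding to a character of `M ⊗_R N`. -/
def curryCharacter {M : ModuleCat.{u} Rᵐᵒᵖ} {N : ModuleCat.{u} R}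
    (χ : BalancedTensor R M N →+ AddCircle (1 : ℚ)) : N ⟶ charOfRight M :=
  ModuleCat.ofHom (Y := charOfRight M) <| toCharOfRight M
    (AddMonoidHom.mk' (fun x => AddMonoidHom.mk' (fun m => χ (QuotientAddGroup.mk (m ⊗ₜ[ℤ] x)))
        fun m m' => by rw [TensorProduct.add_tmul, QuotientAddGroup.mk_add, map_add])
      fun x y => AddMonoidHom.ext fun m => by simp [TensorProduct.tmul_add])
    fun r x m => (congrArg χ (mk_smul_tmul m r x)).symm

@[simp]
theorem curryCharacter_apply {M : ModuleCat.{u} Rᵐᵒᵖ} {N : ModuleCat.{u} R}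
    (χ : BalancedTensor R M N →+ AddCircle (1 : ℚ)) (x : N) (m : M) :
    rightEval M ((curryCharacter χ).hom x) m = χ (QuotientAddGroup.mk (m ⊗ₜ[ℤ] x)) := rfl

/-- The character of `M ⊗_R N` corresponding to a homomorphism `N → Hom_ℤ(M, ℚ/ℤ)`. -/
noncomputable def uncurryCharacter {M : ModuleCat.{u} Rᵐᵒᵖ} {N : ModuleCat.{u} R}
    (f : N ⟶ charOfRight M) : BalancedTensor R M N →+ AddCircle (1 : ℚ) :=
  QuotientAddGroup.lift _
    (TensorProduct.liftAddHom
      (AddMonoidHom.flip ((rightEval M).toAddMonoidHom.comp f.hom.toAddMonoidHom))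
      (fun z m x => by simp)) <| by
    refine (AddSubgroup.closure_le _).2 ?_
    rintro _ ⟨m, r, x, rfl⟩
    change TensorProduct.liftAddHom _ _ _ = 0
    rw [map_sub, TensorProduct.liftAddHom_tmul, TensorProduct.liftAddHom_tmul, sub_eq_zero]
    simp

@[simp]
theorem uncurryCharacter_mk {M : ModuleCat.{u} Rᵐᵒᵖ} {N : ModuleCat.{u} R}
    (f : N ⟶ charOfRight M) (m : M) (x : N) :
    uncurryCharacter f (QuotientAddGroup.mk (m ⊗ₜ[ℤ] x)) = rightEval M (f.hom x) m := rfl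

theorem character_balancedTensor_ext {M N : Type u} [AddCommGroup M] [Module Rᵐᵒᵖ M]
    [AddCommGroup N] [Module R N] {g h : BalancedTensor R M N →+ AddCircle (1 : ℚ)}
    (H : ∀ (m : M) (n : N), g (QuotientAddGroup.mk (m ⊗ₜ[ℤ] n)) =
      h (QuotientAddGroup.mk (m ⊗ₜ[ℤ] n))) : g = h := by
  ext x
  induction x using TensorProduct.induction_on with
  | zero => exact (map_zero g).trans (map_zero h).symm
  | tmul m n => exact H m n
  | add x y hx hy =>
    simp only [AddMonoidHom.comp_apply] at hx hy ⊢
    rw [map_add, map_add, map_add, hx, hy]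

theorem curryCharacter_uncurryCharacter {M : ModuleCat.{u} Rᵐᵒᵖ} {N : ModuleCat.{u} R}
    (f : N ⟶ charOfRight M) : curryCharacter (uncurryCharacter f) = f :=
  ModuleCat.hom_ext (LinearMap.ext fun x => charOfRight_ext fun m => by simp)

theorem uncurryCharacter_curryCharacter {M : ModuleCat.{u} Rᵐᵒᵖ} {N : ModuleCat.{u} R}
    (χ : BalancedTensor R M N →+ AddCircle (1 : ℚ)) :
    uncurryCharacter (curryCharacter χ) = χ :=
  character_balancedTensor_ext fun _ _ => by simp

theorem curryCharacter_comp {M : ModuleCat.{u} Rᵐᵒᵖ} {N N' : ModuleCat.{u} R} (f : N ⟶ N')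
    (χ : BalancedTensor R M N' →+ AddCircle (1 : ℚ)) :
    curryCharacter (χ.comp (balancedTensorMap M f.hom)) = f ≫ curryCharacter χ :=
  ModuleCat.hom_ext (LinearMap.ext fun x => charOfRight_ext fun m => by
    simp [balancedTensorMap, intTensorMap_tmul])

/-- A projective resolution computes the vanishing of `Ext`. -/
theorem subsingleton_ext_iff {N Y : ModuleCat.{u} R} (P : ProjectiveResolution N) (n : ℕ) :
    Subsingleton (Abelian.Ext.{u} N Y (n + 1)) ↔
      ∀ f : P.complex.X (n + 1) ⟶ Y, P.complex.d (n + 2) (n + 1) ≫ f = 0 →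
        ∃ g : P.complex.X n ⟶ Y, P.complex.d (n + 1) n ≫ g = f := by
  constructor
  · intro h f hf
    exact (P.extMk_eq_zero_iff f (n + 2) rfl hf n rfl).1 (Subsingleton.elim _ _)
  · intro h
    refine subsingleton_of_forall_eq 0 fun α => ?_
    obtain ⟨f, hf, rfl⟩ := P.extMk_surjective α (n + 2) rfl
    exact (P.extMk_eq_zero_iff f (n + 2) rfl hf n rfl).2 (h f hf)

/-- A projective resolution computes the vanishing of `Tor`. -/
theorem subsingleton_tor_iff {M : ModuleCat.{u} Rᵐᵒᵖ} {N : ModuleCat.{u} R}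
    (P : ProjectiveResolution N) (n : ℕ) :
    Subsingleton (Tor (n + 1) M N) ↔
      ∀ x, balancedTensorMap M (P.complex.d (n + 1) n).hom x = 0 →
        ∃ y, balancedTensorMap M (P.complex.d (n + 2) (n + 1)).hom y = x := by
  have h1 : Subsingleton (Tor (n + 1) M N) ↔ Limits.IsZero (Tor (n + 1) M N) :=
    ⟨fun _ => AddCommGrpCat.isZero_of_subsingleton _, fun h => AddCommGrpCat.subsingleton_of_isZero h⟩
  rw [h1]
  have e := P.isoLeftDerivedObj (tensorFunctor M) (n + 1)
  have h2 : Limits.IsZero (Tor (n + 1) M N) ↔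
      (((tensorFunctor M).mapHomologicalComplex (ComplexShape.down ℕ)).obj P.complex).ExactAt
        (n + 1) := by
    rw [HomologicalComplex.exactAt_iff_isZero_homology]
    exact e.isZero_iff
  rw [h2, HomologicalComplex.exactAt_iff' _ (n + 2) (n + 1) n (by simp) (by simp),
    ShortComplex.ab_exact_iff]
  rfl

/-- Tensor-hom adjunction: the dual of the complex M ⊗ P is Hom(P, M*), and dualizing preserves and
reflects exactness. -/
theorem subsingleton_tor_iff_subsingleton_ext (M : ModuleCat.{u} Rᵐᵒᵖ) (N : ModuleCat.{u} R)
    (n : ℕ) : Subsingleton (Tor (n + 1) M N) ↔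
      Subsingleton (Abelian.Ext.{u} N (charOfRight M) (n + 1)) := by
  have P : ProjectiveResolution N := projectiveResolution N
  -- The cocycle condition on a map into M* matches vanishing of its character on the image.
  have hcomp : ∀ {A B : ModuleCat.{u} R} (f : A ⟶ B)
      (χ : BalancedTensor R M B →+ AddCircle (1 : ℚ)),
      f ≫ curryCharacter χ = 0 ↔ ∀ a, χ (balancedTensorMap M f.hom a) = 0 := by
    intro A B f χ
    rw [← curryCharacter_comp]
    constructor
    · intro h a
      have := congrArg uncurryCharacter h
      rw [uncurryCharacter_curryCharacter] at this
      refine (DFunLike.congr_fun this a).trans ?_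
      have h0 : uncurryCharacter (0 : A ⟶ charOfRight M) = 0 :=
        character_balancedTensor_ext fun _ _ => by simp
      rw [h0]; rfl
    · intro h
      have : χ.comp (balancedTensorMap M f.hom) = 0 := AddMonoidHom.ext h
      rw [this]
      exact ModuleCat.hom_ext (LinearMap.ext fun x => charOfRight_ext fun m => by simp)
  rw [subsingleton_tor_iff P, subsingleton_ext_iff P, exact_iff_character_exact]
  constructor
  · intro h f hf
    obtain ⟨ψ, hψ⟩ := h (uncurryCharacter f)
      ((hcomp _ _).1 (by rwa [curryCharacter_uncurryCharacter]))
    refine ⟨curryCharacter ψ, ?_⟩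
    rw [← curryCharacter_comp, ← curryCharacter_uncurryCharacter f]
    exact congrArg curryCharacter (AddMonoidHom.ext hψ)
  · intro h χ hχ
    obtain ⟨g, hg⟩ := h (curryCharacter χ) ((hcomp _ _).2 hχ)
    refine ⟨uncurryCharacter g, fun b => ?_⟩
    rw [← curryCharacter_uncurryCharacter g, ← curryCharacter_comp] at hg
    have := congrArg uncurryCharacter hg
    rw [uncurryCharacter_curryCharacter, uncurryCharacter_curryCharacter] at this
    exact DFunLike.congr_fun this b

theorem isFlat_iff_isInjective {n : ℕ} (hn : 1 ≤ n) (X : Set (ModuleCat.{u} R))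
    (M : ModuleCat.{u} Rᵐᵒᵖ) : IsFlat n X M ↔ IsInjective n X (charOfRight M) := by
  obtain ⟨m, rfl⟩ := Nat.exists_eq_add_of_le' hn
  exact forall₂_congr fun N _ => subsingleton_tor_iff_subsingleton_ext M N m

end TorExt

/-! ### Finite presentations, one step at a time. -/

section Presentations

variable {R : Type u} [Ring R]

/-- Cutting the sequence at the kernel of F₀ → N makes induction on n possible, in step with
dimension shifting. -/
theorem isNPresented_succ_iff (n : ℕ) (N : ModuleCat.{u} R) :
    IsNPresented (n + 1) N ↔ ∃ (k : ℕ) (ε : (Fin k → R) →ₗ[R] N),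
      Function.Surjective ε ∧ IsNPresented n (ModuleCat.of R (LinearMap.ker ε)) := by
  constructor
  · rintro ⟨k, ε, d, hε, h0, hd⟩
    have hz : ∀ x, d 0 x ∈ LinearMap.ker ε := fun x => (h0 n.succ_pos).apply_apply_eq_zero x
    refine ⟨k 0, ε, hε, fun i => k (i + 1), (d 0).codRestrict (LinearMap.ker ε) hz,
      fun i => d (i + 1), ?_, ?_, fun i hi => hd (i + 1) (by omega)⟩
    · rintro ⟨y, hy⟩
      obtain ⟨x, rfl⟩ := (h0 n.succ_pos y).1 hy
      exact ⟨x, rfl⟩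
    · intro hn x
      rw [← hd 0 (by omega) x]
      exact Subtype.ext_iff
  · rintro ⟨k, ε, hε, l, η, d, hη, h0, hd⟩
    refine ⟨fun i => Nat.casesOn i k l, ε, fun i => Nat.casesOn i
      ((LinearMap.ker ε).subtype ∘ₗ η) d, hε, fun _ y => ?_, ?_⟩
    · constructor
      · intro hy
        obtain ⟨x, hx⟩ := hη ⟨y, hy⟩
        exact ⟨x, congrArg Subtype.val hx⟩
      · rintro ⟨x, rfl⟩
        exact (η x).2
    · rintro (_ | i) hi
      · intro x
        rw [← h0 (by omega) x]
        exact (Subtype.ext_iff (a1 := η x) (a2 := 0)).symm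
      · exact hd i (by omega)

theorem isNPresented_zero_iff (N : ModuleCat.{u} R) :
    IsNPresented 0 N ↔ ∃ (k : ℕ) (ε : (Fin k → R) →ₗ[R] N), Function.Surjective ε := by
  constructor
  · rintro ⟨k, ε, d, hε, -⟩
    exact ⟨k 0, ε, hε⟩
  · rintro ⟨k, ε, hε⟩
    exact ⟨fun _ => k, ε, fun _ => 0, hε, by simp, by simp⟩

end Presentations

/-! ### Dimension shifting for Ext. -/

section DimensionShift

open Abelian

variable {C : Type*} [Category* C] [Abelian C] [HasExt.{u} C] {S : ShortComplex C}

/-- Ext^1(X₂, Y) = 0, so Ext^1(X₃, Y) is the cokernel of Hom(X₂, Y) → Hom(X₁, Y). -/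
theorem subsingleton_ext_one_iff (hS : S.ShortExact) [Projective S.X₂] (Y : C) :
    Subsingleton (Ext.{u} S.X₃ Y 1) ↔ ∀ φ : S.X₁ ⟶ Y, ∃ ψ : S.X₂ ⟶ Y, S.f ≫ ψ = φ := by
  constructor
  · intro h φ
    obtain ⟨x, hx⟩ := Ext.contravariant_sequence_exact₁ hS Y (Ext.mk₀ φ) (n₁ := 1) rfl
      (Subsingleton.elim _ _)
    obtain ⟨ψ, rfl⟩ := (Ext.mk₀_bijective _ _).2 x
    rw [Ext.mk₀_comp_mk₀] at hx
    exact ⟨ψ, (Ext.mk₀_bijective _ _).1 hx⟩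
  · intro h
    refine subsingleton_of_forall_eq 0 fun x => ?_
    obtain ⟨y, rfl⟩ := Ext.contravariant_sequence_exact₃ hS Y x (Ext.eq_zero_of_projective _)
      (n₀ := 0) rfl
    obtain ⟨φ, rfl⟩ := (Ext.mk₀_bijective _ _).2 y
    obtain ⟨ψ, rfl⟩ := h φ
    rw [← Ext.mk₀_comp_mk₀]
    exact hS.extClass_comp_assoc _

theorem subsingleton_ext_add_two_iff (hS : S.ShortExact) [Projective S.X₂] (Y : C) (n : ℕ) :
    Subsingleton (Ext.{u} S.X₃ Y (n + 2)) ↔ Subsingleton (Ext.{u} S.X₁ Y (n + 1)) := by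
  constructor
  · intro h
    refine subsingleton_of_forall_eq 0 fun x => ?_
    obtain ⟨y, rfl⟩ := Ext.contravariant_sequence_exact₁ hS Y x (n₁ := n + 2) (by omega)
      (Subsingleton.elim _ _)
    rw [Ext.eq_zero_of_projective y, Ext.comp_zero]
  · intro h
    refine subsingleton_of_forall_eq 0 fun x => ?_
    obtain ⟨y, rfl⟩ := Ext.contravariant_sequence_exact₃ hS Y x (Ext.eq_zero_of_projective _)
      (n₀ := n + 1) (by omega)
    rw [Subsingleton.elim y 0, Ext.comp_zero]

end DimensionShift

/-! ### Ext^1 as an extension problem between free modules. -/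

section KernelSequence

variable {R : Type u} [Ring R] {N : ModuleCat.{u} R} {k : ℕ}

/-- The sequence `ker ε → R ^ k → N`. -/
abbrev kernelSequence (ε : (Fin k → R) →ₗ[R] N) : ShortComplex (ModuleCat.{u} R) :=
  ShortComplex.mk (ModuleCat.ofHom (LinearMap.ker ε).subtype)
    (ModuleCat.ofHom (X := Fin k → R) (Y := N) ε)
    (ModuleCat.hom_ext (LinearMap.ext fun x => x.2))

theorem kernelSequence_shortExact {ε : (Fin k → R) →ₗ[R] N} (hε : Function.Surjective ε) :
    (kernelSequence ε).ShortExact where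
  exact := (ShortComplex.ShortExact.moduleCat_exact_iff_function_exact _).2
    fun y => by simp
  mono_f := (ModuleCat.mono_iff_injective _).2 Subtype.val_injective
  epi_g := (ModuleCat.epi_iff_surjective _).2 hε

instance (ε : (Fin k → R) →ₗ[R] N) : Projective (kernelSequence ε).X₂ :=
  ModuleCat.projective_of_free (Pi.basisFun R (Fin k))

/-- Homomorphisms into `M` that are defined on the image of `g` extend to the codomain of `g`. -/
def ExtendsAlong {A B : Type*} [AddCommGroup A] [AddCommGroup B] [Module R A] [Module R B]
    (g : A →ₗ[R] B) (M : Type*) [AddCommGroup M] [Module R M] : Prop :=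
  ∀ φ : A →ₗ[R] M, (∀ x, g x = 0 → φ x = 0) → ∃ ψ : B →ₗ[R] M, ∀ x, ψ (g x) = φ x

/-- Maps ker ε → M are maps R^a → M killing ker η, which is also the kernel of the composite R^a →
R^k. -/
theorem subsingleton_ext_one_iff_extendsAlong {a : ℕ} {ε : (Fin k → R) →ₗ[R] N}
    (hε : Function.Surjective ε) {η : (Fin a → R) →ₗ[R] LinearMap.ker ε}
    (hη : Function.Surjective η) (M : ModuleCat.{u} R) :
    Subsingleton (Abelian.Ext.{u} N M 1) ↔
      ExtendsAlong ((LinearMap.ker ε).subtype ∘ₗ η) M := by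
  rw [subsingleton_ext_one_iff (kernelSequence_shortExact hε) M]
  constructor
  · intro h φ hφ
    have hle : LinearMap.ker η ≤ LinearMap.ker φ := fun x hx =>
      hφ x (congrArg Subtype.val (show η x = 0 from hx))
    let e := η.quotKerEquivOfSurjective hη
    obtain ⟨ψ, hψ⟩ := h (ModuleCat.ofHom (((LinearMap.ker η).liftQ φ hle) ∘ₗ e.symm.toLinearMap))
    refine ⟨ψ.hom, fun x => ?_⟩
    have h1 := ConcreteCategory.congr_hom hψ (η x)
    refine h1.trans ?_
    have h2 : e.symm (η x) = Submodule.Quotient.mk x := by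
      rw [LinearEquiv.symm_apply_eq]; rfl
    change (LinearMap.ker η).liftQ φ hle (e.symm (η x)) = φ x
    rw [h2]
    rfl
  · intro h φ
    obtain ⟨ψ, hψ⟩ := h (φ.hom ∘ₗ η) fun x hx => by
      have : η x = 0 := Subtype.ext hx
      exact (congrArg φ.hom this).trans (map_zero _)
    refine ⟨ModuleCat.ofHom ψ, ModuleCat.hom_ext (LinearMap.ext fun y => ?_)⟩
    obtain ⟨x, rfl⟩ := hη y
    exact hψ x

end KernelSequence

/-! ### Finite generation of ker g from the extension property. -/

section Coordinates

variable {R : Type u} [Ring R]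

theorem addMonoidHom_pi_apply {A B : Type*} [AddCommGroup A] [AddCommGroup B] {a : ℕ}
    (χ : (Fin a → A) →+ B) (x : Fin a → A) : χ x = ∑ i, χ (Pi.single i (x i)) := by
  rw [← map_sum, Finset.univ_sum_single]

theorem linearMap_apply_eq_sum {a : ℕ} {N : Type*} [AddCommGroup N] [Module R N]
    (f : (Fin a → R) →ₗ[R] N) (x : Fin a → R) : f x = ∑ i, x i • f (Pi.single i 1) := by
  conv_lhs => rw [pi_eq_sum_univ' x, map_sum]
  refine Finset.sum_congr rfl fun i _ => ?_
  rw [map_smul]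

/-- The transpose of a homomorphism of free modules, with entries acting on `E`. -/
def transposeAction {a k : ℕ} (g : (Fin a → R) →ₗ[R] (Fin k → R)) (E : Type*) [AddCommGroup E]
    [Module R E] : (Fin k → E) →+ (Fin a → E) where
  toFun e i := ∑ j, g (Pi.single i 1) j • e j
  map_zero' := by ext i; simp
  map_add' x y := by ext i; simp [Finset.sum_add_distrib]

/-- The right module `R^(I)`. -/
noncomputable abbrev finsuppRight (R : Type u) [Ring R] (I : Type u) : ModuleCat.{u} Rᵐᵒᵖ :=
  ModuleCat.of Rᵐᵒᵖ (I →₀ R)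

/-- The element of the character module of `R^(I)` that applies `ρ` to the `i`-th coordinate. -/
noncomputable def coordCharacter {I : Type u} (i : I) :
    (R →+ AddCircle (1 : ℚ)) →+ charOfRight (finsuppRight R I) where
  toFun ρ := (rightEval (finsuppRight R I)).symm (ρ.comp (Finsupp.applyAddHom i))
  map_zero' := rfl
  map_add' _ _ := rfl

@[simp]
theorem rightEval_coordCharacter {I : Type u} (i : I) (ρ : R →+ AddCircle (1 : ℚ)) (x : I →₀ R) :
    rightEval (finsuppRight R I) (coordCharacter i ρ) x = ρ (x i) := rfl

theorem rightEval_sum_coordCharacter {I : Type u} (d : I →₀ (R →+ AddCircle (1 : ℚ))) (i : I)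
    (r : R) : rightEval (finsuppRight R I) (Finsupp.liftAddHom coordCharacter d)
      (Finsupp.single i r) = d i r := by
  classical
  rw [Finsupp.liftAddHom_apply, Finsupp.sum, map_sum, AddMonoidHom.finsetSum_apply]
  rw [Finset.sum_eq_single i]
  · rw [rightEval_coordCharacter, Finsupp.single_eq_same]
  · intro b _ hb
    rw [rightEval_coordCharacter, Finsupp.single_eq_of_ne hb, map_zero]
  · intro hi
    rw [Finsupp.notMem_support_iff.1 hi]; rfl

theorem op_smul_single {I : Type u} (i : I) (r s : R) :
    (MulOpposite.op r • Finsupp.single i s : I →₀ R) = Finsupp.single i (s * r) := by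
  simp

/-- R^(I)* is a product of copies of the injective module R*. The character x ↦ φ(x)(e_i) extends to
ψ_i on B for each i, and s e_i ↦ ψ_i(s b) reassembles them linearly. -/
theorem extendsAlong_charOfRight_finsuppRight {A B : Type*} [AddCommGroup A] [AddCommGroup B]
    [Module R A] [Module R B] (g : A →ₗ[R] B) (I : Type u) :
    ExtendsAlong g (charOfRight (finsuppRight R I)) := by
  intro φ hφ
  have key : ∀ i : I, ∃ ψ : B →+ AddCircle (1 : ℚ), ∀ x, ψ (g x) =
      rightEval (finsuppRight R I) (φ x) (Finsupp.single i 1) := fun i =>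
    exists_character_comp_eq g.toAddMonoidHom
      ((AddMonoidHom.eval (Finsupp.single i (1 : R))).comp
        ((rightEval (finsuppRight R I)).toAddMonoidHom.comp φ.toAddMonoidHom)) fun x hx => by
      have : φ x = 0 := hφ x hx
      simp [this]
  choose ψ hψ using key
  let F : B →+ ((I →₀ R) →+ AddCircle (1 : ℚ)) :=
    AddMonoidHom.mk' (fun b => Finsupp.liftAddHom fun i =>
      (ψ i).comp ((AddMonoidHom.flip (smulAddHom R B)) b)) fun b c =>
        Finsupp.addHom_ext fun i s => by simp
  have hF : ∀ b i s, F b (Finsupp.single i s) = ψ i (s • b) := fun b i s =>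
    Finsupp.liftAddHom_apply_single _ _ _
  refine ⟨toCharOfRight (finsuppRight R I) F fun r x m => ?_, fun x => (rightEval _).injective <|
    Finsupp.addHom_ext fun i s => ?_⟩
  · induction m using Finsupp.induction_linear with
    | zero => exact (map_zero (F _)).trans ((congrArg _ (smul_zero _)).trans (map_zero (F _))).symm
    | add p q hp hq =>
      exact (map_add (F _) p q).trans ((congrArg₂ _ hp hq).trans
        ((congrArg _ (smul_add _ p q)).trans (map_add (F _) _ _)).symm)
    | single i s =>
      refine (hF _ i s).trans (Eq.trans ?_ (hF x i (s * r)).symm |>.trans ?_)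
      · rw [mul_smul]
      · exact congrArg (F x) (op_smul_single _ _ _).symm
  · refine (hF _ i s).trans ?_
    rw [← map_smul, hψ, map_smul, rightEval_smul]
    congr 1
    exact (op_smul_single _ _ _).trans (by rw [one_mul])

/-- The character of `E ^ a`, for `E` the character module of `R^(ker g)`, which is
given by the tautological family of elements of the kernel of `g`. -/
theorem exists_tautological_character {a k : ℕ} (g : (Fin a → R) →ₗ[R] (Fin k → R)) :
    ∃ τ : (Fin a → charOfRight (finsuppRight R (LinearMap.ker g))) →+ AddCircle (1 : ℚ),
      (∀ e, τ (transposeAction g _ e) = 0) ∧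
      ∀ (ρ : Fin a → R →+ AddCircle (1 : ℚ)) (l : LinearMap.ker g),
        τ (fun i => coordCharacter l (ρ i)) = ∑ i, ρ i (l.1 i) := by
  classical
  let E := charOfRight (finsuppRight R (LinearMap.ker g))
  let D := LinearMap.ker g →₀ (R →+ AddCircle (1 : ℚ))
  -- The value Σ_l Σ_i d_i(l)(l_i) makes sense only for finitely supported families; injectivity of
  -- ℚ/ℤ then extends it to E^a.
  let f₁ : (Fin a → D) →+ (Fin a → E) :=
    AddMonoidHom.mk' (fun d i => Finsupp.liftAddHom coordCharacter (d i)) fun x y => by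
      ext i; simp only [Pi.add_apply, map_add]
  let χ₁ : (Fin a → D) →+ AddCircle (1 : ℚ) :=
    AddMonoidHom.mk' (fun d => ∑ i, Finsupp.liftAddHom
      (fun l : LinearMap.ker g => AddMonoidHom.eval (l.1 i)) (d i)) fun x y => by
      simp only [Pi.add_apply, map_add, Finset.sum_add_distrib]
  -- This makes the prescription "χ₁ on finite families, 0 on transposed images" consistent.
  have hker : ∀ (d : Fin a → D) (e : Fin k → E), f₁ d + transposeAction g E e = 0 → χ₁ d = 0 := by
    intro d e h
    have hd : ∀ (i : Fin a) (l : LinearMap.ker g) (r : R), d i l r =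
        -∑ j, rightEval _ (e j) (Finsupp.single l (r * g (Pi.single i 1) j)) := by
      intro i l r
      have h1 : rightEval _ (f₁ d i + transposeAction g E e i) (Finsupp.single l r) = 0 := by
        rw [← Pi.add_apply, h]; simp
      rw [map_add, AddMonoidHom.add_apply] at h1
      rw [← rightEval_sum_coordCharacter, eq_neg_iff_add_eq_zero, ← h1]
      congr 1
      change _ = rightEval _ (∑ j, _) _
      rw [map_sum, AddMonoidHom.finsetSum_apply]
      refine Finset.sum_congr rfl fun j _ => ?_
      rw [rightEval_smul]
      congr 1
      simp
    let s : Finset (LinearMap.ker g) := Finset.univ.biUnion fun i => (d i).support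
    have h2 : ∀ i, Finsupp.liftAddHom
        (fun l : LinearMap.ker g => AddMonoidHom.eval (l.1 i)) (d i) =
        ∑ l ∈ s, d i l (l.1 i) := fun i => by
      rw [Finsupp.liftAddHom_apply]
      exact Finsupp.sum_of_support_subset _
        (Finset.subset_biUnion_of_mem (fun i => (d i).support) (Finset.mem_univ i)) _
        fun l _ => rfl
    change ∑ i : Fin a, Finsupp.liftAddHom
      (fun l : LinearMap.ker g => AddMonoidHom.eval (l.1 i)) (d i) = 0
    rw [Finset.sum_congr rfl fun i _ => h2 i, Finset.sum_comm]
    -- For fixed l, taking r = l_i in `hd` and summing over i leaves Σ_i l_i g_ij, the j-th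
    -- coordinate of g(l) = 0.
    refine Finset.sum_eq_zero fun l _ => ?_
    rw [Finset.sum_congr rfl fun i _ => hd i l _, Finset.sum_neg_distrib, Finset.sum_comm,
      neg_eq_zero]
    refine Finset.sum_eq_zero fun j _ => ?_
    rw [← map_sum, ← Finsupp.single_finsetSum]
    have h3 : ∑ i, l.1 i * g (Pi.single i 1) j = 0 := by
      have h4 := congrFun (linearMap_apply_eq_sum g l.1) j
      rw [show g l.1 = 0 from l.2, Finset.sum_apply] at h4
      exact h4.symm
    rw [h3, Finsupp.single_zero, map_zero]
  obtain ⟨τ, hτ⟩ := exists_character_comp_eq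
    (A := (Fin a → D) × (Fin k → E)) (f₁.coprod (transposeAction g E)) (χ₁.comp (AddMonoidHom.fst (Fin a → D) (Fin k → E)))
    fun p => hker p.1 p.2
  refine ⟨τ, fun e => ?_, fun ρ l => ?_⟩
  · have := hτ (0, e)
    simpa using this
  · have := hτ (fun i => Finsupp.single l (ρ i), 0)
    simp only [AddMonoidHom.coprod_apply, map_zero, add_zero, AddMonoidHom.comp_apply,
      AddMonoidHom.coe_fst] at this
    have h5 : f₁ (fun i => Finsupp.single l (ρ i)) = fun i => coordCharacter l (ρ i) := by
      funext i
      exact Finsupp.liftAddHom_apply_single _ _ _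
    rw [← h5, this]
    change ∑ i : Fin a, Finsupp.liftAddHom
      (fun l : LinearMap.ker g => AddMonoidHom.eval (l.1 i)) (Finsupp.single l (ρ i)) = _
    exact Finset.sum_congr rfl fun i _ => Finsupp.liftAddHom_apply_single
      (fun l : LinearMap.ker g => AddMonoidHom.eval (l.1 i)) l (ρ i)

/-- If homomorphisms into the character module of `M` extend along `g`, then the relations
`Σ t_i g_ij = 0` in `M` are consequences of the relations of `g`. -/
theorem mem_closure_of_extendsAlong {a k : ℕ} (g : (Fin a → R) →ₗ[R] (Fin k → R))
    (M : ModuleCat.{u} Rᵐᵒᵖ) (hM : ExtendsAlong g (charOfRight M)) (t : Fin a → M)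
    (ht : ∀ j, ∑ i, MulOpposite.op (g (Pi.single i 1) j) • t i = 0) :
    t ∈ AddSubgroup.closure
      {z | ∃ h ∈ LinearMap.ker g, ∃ m : M, z = fun i => MulOpposite.op (h i) • m} := by
  by_contra hn
  obtain ⟨χ, h1, h2⟩ := exists_character_ne_zero_of_notMem _ hn
  -- The map φ(x)(m) = χ(m · x) kills ker g because χ kills the subgroup.
  let φ : (Fin a → R) →ₗ[R] charOfRight M := toCharOfRight M
    (AddMonoidHom.mk' (fun x => AddMonoidHom.mk'
      (fun m => χ fun i => MulOpposite.op (x i) • m) fun m m' => by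
        rw [← map_add]; exact congrArg χ (funext fun i => smul_add _ _ _)) fun x y => AddMonoidHom.ext fun m => by
          exact (congrArg χ (funext fun i =>
            add_smul (MulOpposite.op (x i)) (MulOpposite.op (y i)) m)).trans (map_add χ _ _))
    fun r x m => congrArg χ (funext fun i =>
      mul_smul (MulOpposite.op (x i)) (MulOpposite.op r) m)
  have hφ : ∀ x m, rightEval M (φ x) m = χ fun i => MulOpposite.op (x i) • m := fun _ _ => rfl
  obtain ⟨ψ, hψ⟩ := hM φ fun x hx => charOfRight_ext fun m => by
    rw [hφ, map_zero]
    exact h1 _ (AddSubgroup.subset_closure ⟨x, hx, m, rfl⟩)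
  -- With φ = ψ ∘ g, χ(t) = Σ_j ψ(e_j)(Σ_i t_i g_ij) = 0.
  refine h2 ?_
  rw [addMonoidHom_pi_apply]
  have h3 : ∀ i, χ (Pi.single i (t i)) = ∑ j, rightEval M (ψ (Pi.single j 1))
      (MulOpposite.op (g (Pi.single i 1) j) • t i) := by
    intro i
    have h4 : χ (Pi.single i (t i)) = rightEval M (φ (Pi.single i 1)) (t i) := by
      rw [hφ]
      congr 1
      ext i'
      by_cases hi : i' = i
      · subst hi; simp
      · simp [hi]
    rw [h4, ← hψ, linearMap_apply_eq_sum ψ, map_sum, AddMonoidHom.finsetSum_apply]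
    rfl
  rw [Finset.sum_congr rfl fun i _ => h3 i, Finset.sum_comm]
  refine Finset.sum_eq_zero fun j _ => ?_
  rw [← map_sum, ht, map_zero]

/-- The coordinates t_i in E* of the tautological character satisfy Σ_i t_i g_ij = 0, so t is a
finite sum of terms m · h with h in ker g. A character of R^a killing the span L of these h then
kills every l in ker g, and characters separate points of R^a / L. -/
theorem fg_ker_of_extendsAlong {a k : ℕ} (g : (Fin a → R) →ₗ[R] (Fin k → R))
    (hg : ExtendsAlong g
      (charOfRight (charOfLeft (charOfRight (finsuppRight R (LinearMap.ker g)))))) :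
    (LinearMap.ker g).FG := by
  obtain ⟨τ, hτ, hτ'⟩ := exists_tautological_character g
  let E := charOfRight (finsuppRight R (LinearMap.ker g))
  let t : Fin a → charOfLeft E := fun i =>
    (leftEval E).symm (τ.comp (AddMonoidHom.single (fun _ => E) i))
  have ht : ∀ e : Fin a → E, ∑ i, leftEval E (t i) (e i) = τ e := fun e => by
    rw [addMonoidHom_pi_apply τ]; rfl
  have hmem := mem_closure_of_extendsAlong g _ hg t fun j => charOfLeft_ext fun e => by
    rw [map_sum, AddMonoidHom.finsetSum_apply]
    refine (ht fun i => g (Pi.single i 1) j • e).trans ?_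
    refine Eq.trans ?_ (hτ (Pi.single j e))
    congr 1
    ext i
    change _ = ∑ j', g (Pi.single i 1) j' • (Pi.single j e : Fin k → E) j'
    rw [Finset.sum_eq_single j]
    · rw [Pi.single_eq_same]
    · intro j' _ hj
      rw [Pi.single_eq_of_ne hj, smul_zero]
    · simp
  have key : ∀ x ∈ AddSubgroup.closure {z : Fin a → charOfLeft E |
      ∃ h ∈ LinearMap.ker g, ∃ m : charOfLeft E, z = fun i => MulOpposite.op (h i) • m},
      ∃ L ≤ LinearMap.ker g, L.FG ∧ ∀ ρ : Fin a → R →+ AddCircle (1 : ℚ),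
        (∀ h ∈ L, ∑ i, ρ i (h i) = 0) → ∀ l : LinearMap.ker g,
          ∑ i, leftEval E (x i) (coordCharacter l (ρ i)) = 0 := by
    intro x hx
    induction hx using AddSubgroup.closure_induction with
    | mem x hx =>
      obtain ⟨h, hh, m, rfl⟩ := hx
      refine ⟨Submodule.span R {h}, by simpa using hh, Submodule.fg_span_singleton h,
        fun ρ hρ l => ?_⟩
      simp only [leftEval_smul, MulOpposite.unop_op]
      rw [← map_sum]
      convert map_zero (leftEval E m)
      refine charOfRight_ext fun p => ?_
      rw [map_sum, AddMonoidHom.finsetSum_apply, map_zero]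
      -- Evaluated at p, the element Σ_i h_i · coord_l(ρ_i) is ρ applied to p(l) h, which lies in L.
      exact hρ (p l • h) (Submodule.smul_mem _ _ (Submodule.mem_span_singleton_self h))
    | zero => exact ⟨⊥, bot_le, Submodule.fg_bot, fun ρ _ l => by simp⟩
    | add x y _ _ hx hy =>
      obtain ⟨L₁, h₁, f₁, k₁⟩ := hx
      obtain ⟨L₂, h₂, f₂, k₂⟩ := hy
      refine ⟨L₁ ⊔ L₂, sup_le h₁ h₂, f₁.sup f₂, fun ρ hρ l => ?_⟩
      simp only [Pi.add_apply, map_add, AddMonoidHom.add_apply, Finset.sum_add_distrib]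
      rw [k₁ ρ (fun h hh => hρ h (Submodule.mem_sup_left hh)) l,
        k₂ ρ (fun h hh => hρ h (Submodule.mem_sup_right hh)) l, add_zero]
    | neg x _ hx =>
      obtain ⟨L₁, h₁, f₁, k₁⟩ := hx
      refine ⟨L₁, h₁, f₁, fun ρ hρ l => ?_⟩
      simp only [Pi.neg_apply, map_neg, AddMonoidHom.neg_apply, Finset.sum_neg_distrib]
      rw [k₁ ρ hρ l, neg_zero]
  obtain ⟨L, hL, hfg, hL'⟩ := key t hmem
  suffices h : LinearMap.ker g ≤ L by rwa [le_antisymm h hL]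
  intro l hl
  by_contra hn
  obtain ⟨ξ, h1, h2⟩ := exists_character_ne_zero_of_notMem L.toAddSubgroup (b := l) hn
  let ρ : Fin a → R →+ AddCircle (1 : ℚ) := fun i =>
    ξ.comp (AddMonoidHom.single (fun _ => R) i)
  have hρ : ∀ x : Fin a → R, ∑ i, ρ i (x i) = ξ x := fun x => by
    rw [addMonoidHom_pi_apply ξ]; rfl
  have h3 := hL' ρ (fun h hh => (hρ h).trans (h1 h hh)) ⟨l, hl⟩
  rw [ht, hτ', hρ] at h3
  exact h2 h3

end Coordinates

/-! ### Double duals of Hom from free modules of finite rank. -/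

section DoubleDual

variable {R : Type u} [Ring R]

/-- Precomposition with `g`, as a homomorphism of abelian groups. -/
def precompHom {A B : Type*} [AddCommGroup A] [AddCommGroup B] [Module R A] [Module R B]
    (g : A →ₗ[R] B) (M : Type*) [AddCommGroup M] [Module R M] : (B →ₗ[R] M) →+ (A →ₗ[R] M) :=
  AddMonoidHom.mk' (fun φ => φ ∘ₗ g) fun _ _ => rfl

/-- The character `φ ↦ c (φ x)` of `Hom_R(P, M)`. -/
def evalCharacter {P : Type*} [AddCommGroup P] [Module R P] {M : ModuleCat.{u} R} (x : P)
    (c : charOfLeft M) : (P →ₗ[R] M) →+ AddCircle (1 : ℚ) :=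
  AddMonoidHom.mk' (fun φ => leftEval M c (φ x)) fun _ _ => map_add _ _ _

@[simp]
theorem evalCharacter_apply {P : Type*} [AddCommGroup P] [Module R P] {M : ModuleCat.{u} R}
    (x : P) (c : charOfLeft M) (φ : P →ₗ[R] M) : evalCharacter x c φ = leftEval M c (φ x) := rfl

/-- The natural homomorphism `Hom_R(P, M)** → Hom_R(P, M**)`. -/
def homDoubleDual {P : Type*} [AddCommGroup P] [Module R P] {M : ModuleCat.{u} R}
    (Θ : ((P →ₗ[R] M) →+ AddCircle (1 : ℚ)) →+ AddCircle (1 : ℚ)) :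
    P →ₗ[R] charOfRight (charOfLeft M) :=
  toCharOfRight (charOfLeft M)
    (AddMonoidHom.mk' (fun x => AddMonoidHom.mk' (fun c => Θ (evalCharacter x c)) fun c d => by
        rw [← map_add]; rfl) fun x y => AddMonoidHom.ext fun c => by
          refine Eq.trans (congrArg Θ ?_) (map_add Θ _ _)
          ext φ; simp)
    fun r x c => by
      refine congrArg Θ ?_
      ext φ; simp

@[simp]
theorem rightEval_homDoubleDual {P : Type*} [AddCommGroup P] [Module R P] {M : ModuleCat.{u} R}
    (Θ : ((P →ₗ[R] M) →+ AddCircle (1 : ℚ)) →+ AddCircle (1 : ℚ)) (x : P) (c : charOfLeft M) :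
    rightEval _ (homDoubleDual Θ x) c = Θ (evalCharacter x c) := rfl

theorem homDoubleDual_comp {A B : Type*} [AddCommGroup A] [AddCommGroup B] [Module R A]
    [Module R B] (g : A →ₗ[R] B) {M : ModuleCat.{u} R}
    (Θ : ((B →ₗ[R] M) →+ AddCircle (1 : ℚ)) →+ AddCircle (1 : ℚ)) (x : A) :
    homDoubleDual Θ (g x) =
      homDoubleDual (Θ.comp (AddMonoidHom.compHom' (precompHom g M))) x := rfl

/-- The coordinates in `M*` of a character of `Hom_R(R ^ a, M) = M ^ a`. -/
def characterCoord {a : ℕ} {M : ModuleCat.{u} R} (i : Fin a) :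
    (((Fin a → R) →ₗ[R] M) →+ AddCircle (1 : ℚ)) →+ charOfLeft M :=
  AddMonoidHom.mk' (fun χ => (leftEval M).symm (AddMonoidHom.mk'
    (fun m => χ ((LinearMap.toSpanSingleton R M m) ∘ₗ LinearMap.proj i)) fun m m' => by
      rw [← map_add]; congr 1; ext; simp)) fun χ χ' => rfl

theorem leftEval_characterCoord {a : ℕ} {M : ModuleCat.{u} R} (i : Fin a)
    (χ : ((Fin a → R) →ₗ[R] M) →+ AddCircle (1 : ℚ)) (m : M) :
    leftEval M (characterCoord i χ) m =
      χ ((LinearMap.toSpanSingleton R M m) ∘ₗ LinearMap.proj i) := rfl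

theorem sum_evalCharacter_characterCoord {a : ℕ} {M : ModuleCat.{u} R}
    (χ : ((Fin a → R) →ₗ[R] M) →+ AddCircle (1 : ℚ)) :
    ∑ i, evalCharacter (Pi.single i 1) (characterCoord i χ) = χ := by
  ext φ
  rw [AddMonoidHom.finsetSum_apply]
  simp only [evalCharacter_apply, leftEval_characterCoord]
  rw [← map_sum]
  congr 1
  refine LinearMap.ext fun x => ?_
  rw [LinearMap.sum_apply, linearMap_apply_eq_sum φ x]
  rfl

/-- Since Hom(R^a, M) = M^a is a finite sum, both sides are (M**)^a. -/
theorem homDoubleDual_bijective (a : ℕ) (M : ModuleCat.{u} R) :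
    Function.Bijective (homDoubleDual (P := Fin a → R) (M := M)) := by
  constructor
  · intro Θ Θ' h
    ext χ
    rw [← sum_evalCharacter_characterCoord χ, map_sum, map_sum]
    refine Finset.sum_congr rfl fun i _ => ?_
    rw [← rightEval_homDoubleDual, h, rightEval_homDoubleDual]
  · intro θ
    refine ⟨∑ i, (rightEval (charOfLeft M) (θ (Pi.single i 1))).comp (characterCoord i), ?_⟩
    refine LinearMap.ext fun x => charOfRight_ext fun c => ?_
    rw [linearMap_apply_eq_sum θ x, map_sum, AddMonoidHom.finsetSum_apply,
      rightEval_homDoubleDual, AddMonoidHom.finsetSum_apply]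
    refine Finset.sum_congr rfl fun i _ => ?_
    rw [rightEval_smul, AddMonoidHom.comp_apply]
    refine congrArg _ (charOfLeft_ext fun m => ?_)
    simp [leftEval_characterCoord]

/-- If the kernel of `g` is finitely generated, then `M` and `M**` have the same extension
property along `g`. -/
theorem extendsAlong_doubleDual_iff {a b k : ℕ} (g : (Fin a → R) →ₗ[R] (Fin k → R))
    (h : (Fin b → R) →ₗ[R] (Fin a → R)) (hgh : Function.Exact h g) (M : ModuleCat.{u} R) :
    ExtendsAlong g M ↔ ExtendsAlong g (charOfRight (charOfLeft M)) := by
  have hker : ∀ {Y : Type u} [AddCommGroup Y] [Module R Y] (φ : (Fin a → R) →ₗ[R] Y),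
      (∀ x, g x = 0 → φ x = 0) ↔ ∀ y, φ (h y) = 0 := fun φ =>
    ⟨fun H y => H _ (hgh.apply_apply_eq_zero y), fun H x hx => by
      obtain ⟨y, rfl⟩ := (hgh x).1 hx
      exact H y⟩
  -- The extension property is exactness of Hom(R^k, M) → Hom(R^a, M) → Hom(R^b, M) at the middle
  -- term. It is dualized here once by `h2` and once more below.
  have h1 : ExtendsAlong g M ↔ ∀ φ : (Fin a → R) →ₗ[R] M, precompHom h M φ = 0 →
      ∃ ψ, precompHom g M ψ = φ :=
    forall_congr' fun φ => imp_congr ((hker φ).trans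
      (LinearMap.ext_iff (f := precompHom h M φ) (g := 0)).symm)
      (exists_congr fun ψ => (LinearMap.ext_iff (f := precompHom g M ψ)).symm)
  have h2 : ExtendsAlong g M ↔ ∀ χ : ((Fin a → R) →ₗ[R] M) →+ AddCircle (1 : ℚ),
      AddMonoidHom.compHom' (precompHom g M) χ = 0 →
        ∃ ψ, AddMonoidHom.compHom' (precompHom h M) ψ = χ := by
    rw [h1, exact_iff_character_exact]
    exact forall_congr' fun χ => imp_congr
      (DFunLike.ext_iff (f := AddMonoidHom.compHom' (precompHom g M) χ) (g := 0)).symm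
      (exists_congr fun ψ =>
        (DFunLike.ext_iff (f := AddMonoidHom.compHom' (precompHom h M) ψ)).symm)
  rw [h2, exact_iff_character_exact]
  constructor
  · intro H φ hφ
    obtain ⟨Θ, rfl⟩ := (homDoubleDual_bijective a M).2 φ
    have h3 : Θ.comp (AddMonoidHom.compHom' (precompHom h M)) = 0 :=
      (homDoubleDual_bijective b M).1 <| LinearMap.ext fun y => by
        rw [← homDoubleDual_comp, (hker _).1 hφ y]; rfl
    obtain ⟨Ξ, hΞ⟩ := H Θ (DFunLike.congr_fun h3)
    refine ⟨homDoubleDual Ξ, fun x => ?_⟩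
    rw [homDoubleDual_comp]
    exact charOfRight_ext fun c => hΞ _
  · intro H Θ hΘ
    obtain ⟨ψ, hψ⟩ := H (homDoubleDual Θ) <| (hker _).2 fun y => by
      rw [homDoubleDual_comp]
      exact charOfRight_ext fun c => hΘ _
    obtain ⟨Ξ, rfl⟩ := (homDoubleDual_bijective k M).2 ψ
    refine ⟨Ξ, DFunLike.congr_fun ((homDoubleDual_bijective a M).1 ?_ :
      Ξ.comp (AddMonoidHom.compHom' (precompHom g M)) = Θ)⟩
    exact LinearMap.ext hψ

end DoubleDual

/-! ### Dimension shifting to Ext^1, and flatness of R^(I). -/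

section Main

variable {R : Type u} [Ring R]

theorem subsingleton_ext_doubleDual_iff (n : ℕ) : ∀ {N : ModuleCat.{u} R} (M : ModuleCat.{u} R),
    IsNPresented (n + 2) N → (Subsingleton (Abelian.Ext.{u} N M (n + 1)) ↔
      Subsingleton (Abelian.Ext.{u} N (charOfRight (charOfLeft M)) (n + 1))) := by
  induction n with
  | zero =>
    intro N M hN
    obtain ⟨k, ε, hε, hK⟩ := (isNPresented_succ_iff _ _).1 hN
    obtain ⟨a, η, hη, hL⟩ := (isNPresented_succ_iff _ _).1 hK
    obtain ⟨b, ζ, hζ⟩ := (isNPresented_zero_iff _).1 hL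
    rw [zero_add, subsingleton_ext_one_iff_extendsAlong hε hη,
      subsingleton_ext_one_iff_extendsAlong hε hη]
    refine extendsAlong_doubleDual_iff _ ((LinearMap.ker η).subtype ∘ₗ ζ) (fun x => ?_) M
    constructor
    · intro hx
      obtain ⟨y, hy⟩ := hζ ⟨x, Subtype.ext hx⟩
      exact ⟨y, congrArg Subtype.val hy⟩
    · rintro ⟨y, rfl⟩
      exact congrArg Subtype.val (ζ y).2
  | succ n ih =>
    intro N M hN
    obtain ⟨k, ε, hε, hK⟩ := (isNPresented_succ_iff _ _).1 hN
    have h := kernelSequence_shortExact hε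
    exact (subsingleton_ext_add_two_iff h M n).trans
      ((ih M hK).trans (subsingleton_ext_add_two_iff h _ n).symm)

theorem isNPresented_of_subsingleton_ext (n : ℕ) : ∀ {N : ModuleCat.{u} R},
    IsNPresented (n + 1) N →
    (∀ I : Type u, Subsingleton (Abelian.Ext.{u} N
      (charOfRight (charOfLeft (charOfRight (finsuppRight R I)))) (n + 1))) →
    IsNPresented (n + 2) N := by
  induction n with
  | zero =>
    intro N hN H
    obtain ⟨k, ε, hε, hK⟩ := (isNPresented_succ_iff _ _).1 hN
    obtain ⟨a, η, hη⟩ := (isNPresented_zero_iff _).1 hK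
    -- The index set I is chosen to be ker g itself.
    have hfg := fg_ker_of_extendsAlong _
      ((subsingleton_ext_one_iff_extendsAlong hε hη _).1 (H _))
    have hker : LinearMap.ker ((LinearMap.ker ε).subtype ∘ₗ η) = LinearMap.ker η :=
      LinearMap.ker_comp_of_ker_eq_bot _ (Submodule.ker_subtype _)
    rw [hker] at hfg
    have := Module.Finite.iff_fg.2 hfg
    obtain ⟨b, ζ, hζ⟩ := Module.Finite.exists_fin' R (LinearMap.ker η)
    exact (isNPresented_succ_iff _ _).2 ⟨k, ε, hε, (isNPresented_succ_iff _ _).2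
      ⟨a, η, hη, (isNPresented_zero_iff _).2 ⟨b, ζ, hζ⟩⟩⟩
  | succ n ih =>
    intro N hN H
    obtain ⟨k, ε, hε, hK⟩ := (isNPresented_succ_iff _ _).1 hN
    exact (isNPresented_succ_iff _ _).2 ⟨k, ε, hε, ih hK fun I =>
      (subsingleton_ext_add_two_iff (kernelSequence_shortExact hε) _ n).1 (H I)⟩

instance injective_charOfRight_finsuppRight (I : Type u) :
    Injective (charOfRight (finsuppRight R I)) where
  factors {A B} φ g _ := by
    have hg := (ModuleCat.mono_iff_injective g).1 inferInstance
    obtain ⟨ψ, hψ⟩ := extendsAlong_charOfRight_finsuppRight g.hom I φ.hom fun x hx => by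
      rw [(injective_iff_map_eq_zero g.hom).1 hg x hx, map_zero]
    exact ⟨ModuleCat.ofHom (Y := charOfRight _) ψ, ModuleCat.hom_ext (LinearMap.ext hψ)⟩

theorem isFlat_finsuppRight {n : ℕ} (hn : 1 ≤ n) (X : Set (ModuleCat.{u} R)) (I : Type u) :
    IsFlat n X (finsuppRight R I) := by
  rw [isFlat_iff_isInjective hn]
  obtain ⟨m, rfl⟩ := Nat.exists_eq_add_of_le' hn
  exact fun N _ => subsingleton_of_forall_eq 0 Abelian.Ext.eq_zero_of_injective

end Main
end RelCoherent

theorem mainTheorem2 {R : Type u} [Ring R] [Nontrivial R] (n : ℕ) (hn : 1 ≤ n)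
    (X : Set (ModuleCat.{u} R)) (hX : (RelCoherent.nPresentedPart n X).Nonempty) :
    List.TFAE [
      RelCoherent.IsLeftCoherent n X,
      ∀ M : ModuleCat.{u} R,
        RelCoherent.IsInjective n X M ↔ RelCoherent.IsFlat n X (RelCoherent.charOfLeft M),
      ∀ M : ModuleCat.{u} R,
        RelCoherent.IsInjective n X M ↔
          RelCoherent.IsInjective n X (RelCoherent.charOfRight (RelCoherent.charOfLeft M)),
      ∀ M : ModuleCat.{u} Rᵐᵒᵖ,
        RelCoherent.IsFlat n X M ↔
          RelCoherent.IsFlat n X (RelCoherent.charOfLeft (RelCoherent.charOfRight M))] := by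
  have key := RelCoherent.isFlat_iff_isInjective hn X
  tfae_have 1 → 2 := by
    intro h M
    obtain ⟨m, rfl⟩ := Nat.exists_eq_add_of_le' hn
    rw [key]
    exact forall₂_congr fun N hN =>
      RelCoherent.subsingleton_ext_doubleDual_iff m M (h.2 N hN)
  tfae_have 2 → 3 := fun h M => by rw [← key, h]
  tfae_have 3 → 4 := fun h M => by rw [key, key, h]
  tfae_have 4 → 1 := by
    intro h
    refine ⟨hX, fun N hN => ?_⟩
    -- Flatness of R^(I)** is injectivity of R^(I)***.
    have hinj := fun I => (key _).1 ((h _).1 (RelCoherent.isFlat_finsuppRight hn X I))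
    obtain ⟨m, rfl⟩ := Nat.exists_eq_add_of_le' hn
    exact RelCoherent.isNPresented_of_subsingleton_ext m hN.2 fun I => hinj I N hN
  tfae_finish
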